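/- **Theorem (Convergence in Bayes risk).** Let $d\in\mathbb N$, let $\|\cdot\|$ be a norm on $\mathbb R^d$, let $L\in\mathbb R$ and $\kappa>0$, and write $\Delta_t=\kappa\,t^{-1/(d+2)}$. Let $\pi:[0,1]^d\to[0,1]$ satisfy $|\pi(x)-\pi(y)|\le L\|x-y\|$ for all $x,y$. For $t\ge 1$, experiment points $x_1,\dots,x_t$ are i.i.d. uniform on $[0,1]^d$, the results $s_1,\dots,s_t\in\{0,1\}$ are conditionally independent given the points (and, in setting 3, the noises), and $\mathcal S$ denotes all the data. For a query point $x$ let $n$ be the number of $i$ with $\|x-x_i\|\le\Delta_t$ and $S$ the number of those with $s_i=1$. For $B\in[0,1)$ let $$\mathcal P_B(n,S)=\sum_{i=0}^{S}C_i\,\mathrm{Beta}(1+i,\,1+n-i),\qquad C_i\propto\binom{S}{i}\,i!\,(n-i)!\,B^{S-i},\quad \sum_{i=0}^S C_i=1,$$ which is the Bayesian posterior of $\theta$ under a uniform prior after $n$ tests of success probability $(1-B)\theta+B$ of which $S$ succeeded. Consider the following settings, each with a posterior $\tilde\pi(x|\mathcal S)$ built from the uniform prior $\mathrm{Beta}(1,1)$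 at every $x$. 1. *Static setting (Smooth Beta Process).* $s_i\sim\mathrm{Bernoulli}(\pi(x_i))$ and $\tilde\pi(x|\mathcal S)\sim\mathrm{Beta}(1+S,\,1+n-S)$. 2. *Constant context.* $\pi>0$, $B\in[0,1)$, $s_i\sim\mathrm{Bernoulli}((1-B)\pi(x_i)+B)$, and $\tilde\pi(x|\mathcal S)\sim\mathcal P_B(n,S)$. 3. *Noisy varying contexts (Contextual Smooth Beta Process).* $\pi>0$, $B_1,\dots,B_t\in[0,b]$ with $b<1$, and $s_i\sim\mathrm{Bernoulli}((1-(B_i+\epsilon_i))\pi(x_i)+B_i+\epsilon_i)$, where the $\epsilon_i$ are independent of each other and of the points, have mean zero and variance $\sigma^2$, and are almost surely such that $(1-(B_i+\epsilon_i))\pi(y)+B_i+\epsilon_i\in[0,1]$ for all $y\in[0,1]^d$. Here $\tilde\pi(x|\mathcal S)\sim\mathcal P_{\bar B}(n,S)$, where $\bar B$ is the mean of the $B_i$ over the $i$ with $\|x-x_i\|\le\Delta_t$ (for $n=0$ the posterior is the prior). Let $\tilde s(x|\mathcal S)=1$ if the posterior mean $\mathbb E[\tilde\pi(x|\mathcal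 S)]$ is at least $1/2$, and $\tilde s(x|\mathcal S)=0$ otherwise; let $R(\tilde s,x)=\mathbb P_{s\sim\mathrm{Bernoulli}(\pi(x))}[s\ne\tilde s(x|\mathcal S)]$, and let $R^*(x)=\min\{\pi(x),1-\pi(x)\}$ be the Bayes-optimal risk. Then in each setting there is a constant $C$ such that, for all $t\ge1$ and all $x\in[0,1]^d$, $$\mathbb E_{\mathcal S}\big[R(\tilde s,x)\big]\le R^*(x)+C\,t^{-1/(d+2)} .$$ The constant $C$ depends only on $d$, $\|\cdot\|$, $L$ and $\kappa$, in setting 2 also on $B$, and in setting 3 also on $b$ and $\sigma^2$. -/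

import Mathlib

open MeasureTheory ProbabilityTheory

noncomputable section

/-- The feature space `[0,1]^d`. Its `volume` is the uniform probability distribution. -/
abbrev Cube (d : ℕ) : Type := Fin d → unitInterval

/-- A data set `(x_i, s_i)`, `i = 1, …, t`: experiment points and their results
(`true` is a success, `s_i = 1`). -/
abbrev DataSet (d t : ℕ) : Type := Fin t → Cube d × Bool

/-- The distance `‖x - y‖` of two points of the cube, for the (semi)norm `N` on `ℝ^d`. -/
def cubeDist {d : ℕ} (N : Seminorm ℝ (Fin d → ℝ)) (x y : Cube d) : ℝ :=
  N (fun j => (x j : ℝ) - (y j : ℝ))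

/-- `L`-Lipschitz continuity of `π : [0,1]^d → [0,1]` with respect to `N`. -/
def IsLipschitz {d : ℕ} (N : Seminorm ℝ (Fin d → ℝ)) (L : ℝ) (π : Cube d → unitInterval) : Prop :=
  ∀ x y, |(π x : ℝ) - (π y : ℝ)| ≤ L * cubeDist N x y

/-- The point of `[0,1]` given by a real number `p ∈ [0,1]` (other reals are clipped). -/
def toUnit (p : ℝ) : unitInterval := Set.projIcc 0 1 zero_le_one p

/-! ### The experiments -/

/-- The joint law of `(z, s)` where `z ∼ ρ` and, given `z`, `s ∼ Bernoulli (q z)`. -/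
def trialLaw {Z : Type*} [MeasurableSpace Z] (ρ : Measure Z) (q : Z → unitInterval) :
    Measure (Z × Bool) :=
  ρ.bind fun z => (bernoulliMeasure true false (q z)).map (Prod.mk z)

/-- Static setting: the `x_i` are i.i.d. uniform on the cube, `s_i ∼ Bernoulli (π (x_i))`. -/
def staticLaw {d : ℕ} (t : ℕ) (π : Cube d → unitInterval) : Measure (DataSet d t) :=
  Measure.pi fun _ => trialLaw volume π

/-- Constant context `(A, B) = (1 - B, B)`: the `x_i` are i.i.d. uniform on the cube and
`s_i ∼ Bernoulli ((1 - B) π (x_i) + B)`. -/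
def constLaw {d : ℕ} (t : ℕ) (π : Cube d → unitInterval) (B : ℝ) : Measure (DataSet d t) :=
  Measure.pi fun _ => trialLaw volume fun x => toUnit ((1 - B) * π x + B)

/-- The success probability `(1 - (B + e)) π (x) + B + e` at `x` with context `B` and noise `e`. -/
def noisyProb {d : ℕ} (π : Cube d → unitInterval) (B e : ℝ) (x : Cube d) : ℝ :=
  (1 - (B + e)) * π x + (B + e)

/-- Noisy contexts: the points `x_i` (uniform on the cube) and the noises `ε_i ∼ ν_i` are all
independent, and `s_i ∼ Bernoulli ((1 - (B_i + ε_i)) π (x_i) + B_i + ε_i)`. The noises are not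
observed: this is the law of `(x_i, s_i)`, `i = 1, …, t`. -/
def noisyLaw {d t : ℕ} (π : Cube d → unitInterval) (B : Fin t → ℝ) (ν : Fin t → Measure ℝ) :
    Measure (DataSet d t) :=
  Measure.pi fun i =>
    (trialLaw ((volume : Measure (Cube d)).prod (ν i))
      (fun z => toUnit (noisyProb π (B i) z.2 z.1))).map (fun w => (w.1.1, w.2))

/-! ### The algorithms

The kernel width is `Δ = κ t^{-1/(d+2)}`. -/

/-- The kernel width `Δ = κ t^{-1/(d+2)}`. -/
def width (d t : ℕ) (κ : ℝ) : ℝ := κ * (t : ℝ) ^ (-(1 / ((d : ℝ) + 2)))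

open Classical in
/-- The kernel `K(x, y) = 1` if `‖x - y‖ ≤ Δ`, and `0` otherwise. -/
def boxKernel {d : ℕ} (N : Seminorm ℝ (Fin d → ℝ)) (Δ : ℝ) (x y : Cube d) : ℝ :=
  if cubeDist N x y ≤ Δ then 1 else 0

/-- Smooth Beta Process: the posterior at `x` is
`Beta (α + ∑_i δ_{s_i = 1} K(x, x_i), β + ∑_i δ_{s_i = 0} K(x, x_i))`. -/
def sbpPosterior {d t : ℕ} (N : Seminorm ℝ (Fin d → ℝ)) (Δ α β : ℝ) (D : DataSet d t)
    (x : Cube d) : Measure ℝ :=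
  betaMeasure
    (α + ∑ i, if (D i).2 = true then boxKernel N Δ x (D i).1 else 0)
    (β + ∑ i, if (D i).2 = false then boxKernel N Δ x (D i).1 else 0)

/-- The unnormalised weight `binom(S, i) (α - 1 + i)! (β + n - 1 - i)! B^{S - i}`. -/
def ctxWeight (α β B : ℝ) (n S i : ℕ) : ℝ :=
  (S.choose i : ℝ) * Real.Gamma (α + i) * Real.Gamma (β + n - i) * B ^ (S - i)

/-- The Bayesian posterior of a `Beta (α, β)` prior after `n` tests with success probability
`(1 - B) θ + B`, of which `S` succeeded: `∑_{i=0}^S C_i Beta (α + i, β + n - i)`, with `C_i`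
proportional to `ctxWeight α β B n S i` and of sum one. -/
def ctxPosterior (α β B : ℝ) (n S : ℕ) : Measure ℝ :=
  ∑ i ∈ Finset.range (S + 1),
    ENNReal.ofReal (ctxWeight α β B n S i / ∑ j ∈ Finset.range (S + 1), ctxWeight α β B n S j) •
      betaMeasure (α + i) (β + n - i)

open Classical in
/-- The (indices of the) neighbouring experiments, `‖x - x_i‖ ≤ Δ`. -/
def neighbors {d t : ℕ} (N : Seminorm ℝ (Fin d → ℝ)) (Δ : ℝ) (D : DataSet d t) (x : Cube d) :
    Finset (Fin t) :=
  Finset.univ.filter fun i => cubeDist N x (D i).1 ≤ Δ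

/-- The number of successes among the experiments with index in `s`. -/
def successes {d t : ℕ} (D : DataSet d t) (s : Finset (Fin t)) : ℕ :=
  (s.filter fun i => (D i).2 = true).card

/-- Simplified dynamic setting, constant context `(1 - B, B)`: the neighbouring experiments are
used as if performed at `x`. -/
def dynPosterior {d t : ℕ} (N : Seminorm ℝ (Fin d → ℝ)) (Δ α β B : ℝ) (D : DataSet d t)
    (x : Cube d) : Measure ℝ :=
  ctxPosterior α β B (neighbors N Δ D x).card (successes D (neighbors N Δ D x))

/-- The mean of the `B_i`, `i ∈ s`. -/
def meanContext {t : ℕ} (B : Fin t → ℝ) (s : Finset (Fin t)) : ℝ := (∑ i ∈ s, B i) / s.card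

/-- Contextual Smooth Beta Process, contexts `(1 - B_i, B_i)`: the neighbouring experiments are
used as if performed at `x`, all with the mean context of the neighbours. -/
def csbpPosterior {d t : ℕ} (N : Seminorm ℝ (Fin d → ℝ)) (Δ α β : ℝ) (B : Fin t → ℝ)
    (D : DataSet d t) (x : Cube d) : Measure ℝ :=
  ctxPosterior α β (meanContext B (neighbors N Δ D x)) (neighbors N Δ D x).card
    (successes D (neighbors N Δ D x))

/-! ### Classification -/

/-- The plug-in classification from a posterior: class `1` if and only if the posterior mean is at
least `1/2`. For `Beta (a, b)` the mean is `a / (a + b)`. -/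
def plugIn (ρ : Measure ℝ) : Bool := decide (1 / 2 ≤ ∫ θ, θ ∂ρ)

/-- The risk `ℙ_{s ∼ Bernoulli (p)} (s ≠ b)` of the prediction `b`. -/
def risk (p : unitInterval) (b : Bool) : ℝ := (bernoulliMeasure true false p).real {s | s ≠ b}

/-- The risk of the (data-dependent) prediction `f` has expectation at most
`min {p, 1 - p} + r` when the data have law `P`. -/
def ExpectedRiskLE {Ω : Type*} [MeasurableSpace Ω] (P : Measure Ω) (p : unitInterval)
    (f : Ω → Bool) (r : ℝ) : Prop :=
  Integrable (fun D => risk p (f D)) P ∧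
    ∫ D, risk p (f D) ∂P ≤ min (p : ℝ) (1 - p) + r

end

/-! ### Means of Beta distributions and of context posteriors -/

/-! Plug-in classification loses at most twice the error of the posterior mean
(`risk_plugIn_sub_le`), so it suffices to bound the expected error of that mean, capped because the
excess risk is at most 1.

Deterministic part. Write `a = (S + 1) / (n + 2)`. In the static setting `a` is the posterior mean.
With context `B` the posterior mean `μ` has no closed form, but consecutive mixture weights have a
simple ratio, and summation by parts gives identities for the first two moments of the mixing index.
With Cauchy–Schwarz they yield `a ≤ (1 - B) μ + B` and `μ ((1 - B) μ + B - a) ≤ 1 / (n + 2)`. Hence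
`(1 - B) |μ - p|` is at most the distance of `a` from `(1 - B) p + B`, plus `1 / √(n + 2)`
(`abs_integral_ctxPosterior_sub_le`).

Probabilistic part. The success probability is affine in the context and in the noise. Centred noise
therefore integrates out of the law of one trial (`isTrialLaw_noisy`), and the mean context of the
neighbours gives exactly their mean success probability at `x`. What remains in `a` is a Lipschitz
bias of order `Δ`, a sum of centred independent residuals, and the effect of the prior
(`abs_success_rate_sub_le`).

Let `T` be the expected number of neighbours. The residual sum and `n - T` both have variance at
most `T`, hence mean absolute value at most `√T`; after division by `T` each is of order `1 / √T`.
If `n < T / 2`, the deviation `|n - T|` alone pays for the excess risk (`excess_le`). A ball of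
radius `Δ` has volume at least of order `Δ ^ d`, also at the corners of the cube, so `1 / √T` is at
most of order `t^{-1/(d+2)}`, like the bias. -/

lemma betaPDFReal_nonneg_of_pos {a b : ℝ} (ha : 0 < a) (hb : 0 < b) (x : ℝ) : 0 ≤ betaPDFReal a b x := by
  by_cases h : 0 < x ∧ x < 1
  · exact (betaPDFReal_pos h.1 h.2 ha hb).le
  · simp [betaPDFReal, h]

lemma integrable_betaPDFReal {a b : ℝ} (ha : 0 < a) (hb : 0 < b) :
    Integrable (betaPDFReal a b) := by
  refine ⟨by fun_prop, ?_⟩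
  rw [hasFiniteIntegral_iff_ofReal (ae_of_all _ (betaPDFReal_nonneg_of_pos ha hb))]
  have := lintegral_betaPDF_eq_one ha hb
  simp only [betaPDF] at this
  simp [this]

lemma integral_betaPDFReal {a b : ℝ} (ha : 0 < a) (hb : 0 < b) :
    ∫ x, betaPDFReal a b x = 1 := by
  rw [integral_eq_lintegral_of_nonneg_ae (ae_of_all _ (betaPDFReal_nonneg_of_pos ha hb)) (by fun_prop)]
  have := lintegral_betaPDF_eq_one ha hb
  simp only [betaPDF] at this
  simp [this]

/-- Size-biasing a Beta law raises its first parameter by one; integrability and the mean both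
follow from the normalisation of the new density. -/
lemma mul_betaPDFReal {a b : ℝ} (ha : 0 < a) (hb : 0 < b) (x : ℝ) :
    betaPDFReal a b x * x = a / (a + b) * betaPDFReal (a + 1) b x := by
  by_cases h : 0 < x ∧ x < 1
  · have hab : a + b ≠ 0 := by positivity
    have h1 : Real.Gamma (a + b) ≠ 0 := (Real.Gamma_pos_of_pos (by positivity)).ne'
    have h2 := (Real.Gamma_pos_of_pos ha).ne'
    have h3 := (Real.Gamma_pos_of_pos hb).ne'
    have hx : x ^ (a + 1 - 1) = x ^ (a - 1) * x := by
      rw [show a + 1 - 1 = (a - 1) + 1 by ring, Real.rpow_add_one h.1.ne']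
    simp only [betaPDFReal, if_pos h, beta, hx, Real.Gamma_add_one ha.ne',
      show a + 1 + b = (a + b) + 1 by ring, Real.Gamma_add_one hab]
    field_simp
  · simp [betaPDFReal, h]

lemma integrable_id_betaMeasure {a b : ℝ} (ha : 0 < a) (hb : 0 < b) :
    Integrable (fun θ => θ) (betaMeasure a b) := by
  rw [betaMeasure]
  unfold betaPDF
  rw [integrable_withDensity_iff (by fun_prop) (ae_of_all _ fun x => ENNReal.ofReal_lt_top)]
  simp only [ENNReal.toReal_ofReal (betaPDFReal_nonneg_of_pos ha hb _)]
  simp_rw [mul_comm _ (betaPDFReal _ _ _), mul_betaPDFReal ha hb]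
  exact (integrable_betaPDFReal (by positivity) hb).const_mul _

lemma integral_id_betaMeasure {a b : ℝ} (ha : 0 < a) (hb : 0 < b) :
    ∫ θ, θ ∂(betaMeasure a b) = a / (a + b) := by
  rw [betaMeasure]
  unfold betaPDF
  rw [integral_withDensity_eq_integral_toReal_smul (by fun_prop)
    (ae_of_all _ fun x => ENNReal.ofReal_lt_top)]
  simp only [ENNReal.toReal_ofReal (betaPDFReal_nonneg_of_pos ha hb _), smul_eq_mul]
  simp_rw [mul_betaPDFReal ha hb]
  rw [integral_const_mul, integral_betaPDFReal (by positivity) hb, mul_one]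

/-! ### The mixture weights and their moments. -/

lemma ctxWeight_nonneg {B : ℝ} (hB : 0 ≤ B) {n S i : ℕ} (hS : S ≤ n) (hi : i ≤ S) :
    0 ≤ ctxWeight 1 1 B n S i := by
  have h1 : (0 : ℝ) < 1 + n - i := by
    have : (i : ℝ) ≤ n := by exact_mod_cast hi.trans hS
    linarith
  have h2 := (Real.Gamma_pos_of_pos h1).le
  have h3 : 0 ≤ Real.Gamma (1 + (i : ℝ)) := (Real.Gamma_pos_of_pos (by positivity)).le
  unfold ctxWeight
  positivity

lemma ctxWeight_sum_pos {B : ℝ} (hB : 0 ≤ B) {n S : ℕ} (hS : S ≤ n) :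
    0 < ∑ i ∈ Finset.range (S + 1), ctxWeight 1 1 B n S i := by
  refine Finset.sum_pos' (fun i hi => ctxWeight_nonneg hB hS (by simpa [Nat.lt_succ_iff] using hi))
    ⟨S, by simp, ?_⟩
  have h1 : (0 : ℝ) < 1 + n - S := by
    have : (S : ℝ) ≤ n := by exact_mod_cast hS
    linarith
  have h2 := Real.Gamma_pos_of_pos h1
  have h3 : 0 < Real.Gamma (1 + (S : ℝ)) := Real.Gamma_pos_of_pos (by positivity)
  simp only [ctxWeight, Nat.choose_self, Nat.cast_one, one_mul, Nat.sub_self, pow_zero, mul_one]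
  positivity

lemma integral_id_ctxPosterior {B : ℝ} (hB : 0 ≤ B) {n S : ℕ} (hS : S ≤ n) :
    ∫ θ, θ ∂(ctxPosterior 1 1 B n S) =
      (∑ i ∈ Finset.range (S + 1), ctxWeight 1 1 B n S i * (1 + i)) /
        (∑ i ∈ Finset.range (S + 1), ctxWeight 1 1 B n S i) / (n + 2) := by
  have hpos : ∀ i ∈ Finset.range (S + 1), (0 : ℝ) < 1 + i ∧ (0 : ℝ) < 1 + n - i := by
    intro i hi
    have : (i : ℝ) ≤ n := by
      have := Finset.mem_range.1 hi
      exact_mod_cast (by omega : i ≤ n)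
    exact ⟨by positivity, by linarith⟩
  rw [ctxPosterior, integral_finsetSum_measure]
  · rw [Finset.sum_div, Finset.sum_div]
    refine Finset.sum_congr rfl fun i hi => ?_
    rw [integral_smul_measure, integral_id_betaMeasure (hpos i hi).1 (hpos i hi).2,
      ENNReal.toReal_ofReal, smul_eq_mul]
    · rw [show (1 : ℝ) + i + (1 + n - i) = n + 2 by ring]
      ring
    · exact div_nonneg (ctxWeight_nonneg hB hS (by simpa [Nat.lt_succ_iff] using hi))
        (ctxWeight_sum_pos hB hS).le
  · intro i hi
    exact (integrable_id_betaMeasure (hpos i hi).1 (hpos i hi).2).smul_measure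
      ENNReal.ofReal_ne_top

/-- Expanding the likelihood `(θ + B (1 - θ)) ^ S (1 - θ) ^ (n - S)` shows `i` as the number of
tests that would succeed without context. This ratio of consecutive weights is all that is used of
their form. -/
lemma ctxWeight_succ {B : ℝ} {n S i : ℕ} (hS : S ≤ n) (hi : i < S) :
    B * ctxWeight 1 1 B n S (i + 1) * (n - i) = ctxWeight 1 1 B n S i * (S - i) := by
  have hin : (i : ℝ) < n := by exact_mod_cast hi.trans_le hS
  have h1 : Real.Gamma (1 + ((i + 1 : ℕ) : ℝ)) = (1 + i) * Real.Gamma (1 + i) := by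
    rw [← Real.Gamma_add_one (by positivity)]
    push_cast
    ring_nf
  have h2 : Real.Gamma (1 + n - i) = (n - i) * Real.Gamma (1 + n - ((i + 1 : ℕ) : ℝ)) := by
    have : (n : ℝ) - i ≠ 0 := by linarith
    rw [show (1 : ℝ) + n - i = (n - i) + 1 by ring, Real.Gamma_add_one this]
    push_cast
    ring_nf
  have h3 : B ^ (S - i) = B * B ^ (S - (i + 1)) := by
    rw [← pow_succ']
    congr 1
    omega
  have h4 : (S.choose (i + 1) : ℝ) * (i + 1) = S.choose i * (S - i) := by
    have := Nat.choose_succ_right_eq S i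
    rw [← Nat.cast_sub hi.le]
    exact_mod_cast this
  simp only [ctxWeight, h1, h2, h3]
  linear_combination (B * Real.Gamma (1 + i) * Real.Gamma (1 + n - ((i + 1 : ℕ) : ℝ)) *
    B ^ (S - (i + 1)) * (n - i)) * h4

/-- Summation by parts for the weights. -/
lemma ctxWeight_sum_shift {B : ℝ} {n S : ℕ} (hS : S ≤ n) (g : ℕ → ℝ) :
    ∑ i ∈ Finset.range (S + 1), ctxWeight 1 1 B n S i * ((S - i) * g i) =
      B * ∑ i ∈ Finset.range (S + 1), ctxWeight 1 1 B n S i * ((n + 1 - i) * g (i - 1)) -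
        B * (ctxWeight 1 1 B n S 0 * ((n + 1) * g 0)) := by
  rw [Finset.sum_range_succ, Finset.sum_range_succ', sub_self, zero_mul, mul_zero, add_zero]
  rw [mul_add, Finset.mul_sum]
  simp only [Nat.cast_zero, sub_zero, Nat.zero_sub, add_sub_cancel_right]
  refine Finset.sum_congr rfl fun i hi => ?_
  have := ctxWeight_succ (B := B) hS (Finset.mem_range.1 hi)
  push_cast
  linear_combination (-g i) * this

/-- For `μ ≤ p` the first bound suffices. If `μ ≥ p` and the claim failed, both `μ` and `(1 - B) μ +
B - a` would exceed `r`, against the second bound. The product form is what survives when `a < B`: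
the naive estimate `(a - B) / (1 - B)` is then negative while `μ` is not. -/
lemma mul_abs_sub_le_of_mul_le {B p μ a r : ℝ} (hB : 0 ≤ B) (hp : 0 ≤ p)
    (hr : 0 < r) (h1 : a ≤ (1 - B) * μ + B)
    (h2 : μ * ((1 - B) * μ + B - a) ≤ r ^ 2) :
    (1 - B) * |μ - p| ≤ |a - ((1 - B) * p + B)| + r := by
  rcases le_total p μ with hpμ | hpμ
  · rw [abs_of_nonneg (sub_nonneg.2 hpμ)]
    by_contra! hlt
    have he' := le_abs_self (a - ((1 - B) * p + B))
    have he0 := abs_nonneg (a - ((1 - B) * p + B))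
    have k1 : r < (1 - B) * μ + B - a := by linarith
    have k2 : r < μ := by
      have : (1 - B) * (μ - p) ≤ 1 * (μ - p) := by gcongr; linarith
      linarith
    have : r * r < μ * ((1 - B) * μ + B - a) := mul_lt_mul'' k2 k1 hr.le hr.le
    linarith [sq r]
  · rw [abs_of_nonpos (sub_nonpos.2 hpμ)]
    have := neg_le_abs (a - ((1 - B) * p + B))
    linarith

/-- The posterior mean of `θ` is as close to `p` as the smoothed success rate is to the success
probability at `p`, up to the standard deviation. -/
lemma abs_integral_ctxPosterior_sub_le {B : ℝ} (hB : 0 ≤ B) (hB1 : B < 1) {n S : ℕ} (hS : S ≤ n)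
    {p : ℝ} (hp : 0 ≤ p) :
    (1 - B) * |∫ θ, θ ∂(ctxPosterior 1 1 B n S) - p| ≤
      |(S + 1) / (n + 2) - ((1 - B) * p + B)| + 1 / √(n + 2) := by
  rw [integral_id_ctxPosterior hB hS]
  have hW := ctxWeight_sum_pos hB hS
  have hw : ∀ i ∈ Finset.range (S + 1), 0 ≤ ctxWeight 1 1 B n S i :=
    fun i hi => ctxWeight_nonneg hB hS (by simpa [Nat.lt_succ_iff] using hi)
  have h1 := ctxWeight_sum_shift (B := B) hS fun _ => 1
  have h2 := ctxWeight_sum_shift (B := B) hS fun i => i + 1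
  -- At `i = 0` the truncated `i - 1` turns `(i - 1) + 1` into 1 instead of 0; the boundary term of
  -- the summation by parts cancels exactly this.
  have h2' : ∑ i ∈ Finset.range (S + 1),
        ctxWeight 1 1 B n S i * ((n + 1 - i) * (((i - 1 : ℕ) : ℝ) + 1)) -
          (ctxWeight 1 1 B n S 0 * (n + 1)) =
      ∑ i ∈ Finset.range (S + 1), ctxWeight 1 1 B n S i * ((n + 1 - i) * i) := by
    rw [Finset.sum_range_succ', Finset.sum_range_succ']
    simp
  have h0 : 0 ≤ ctxWeight 1 1 B n S 0 := hw 0 (by simp)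
  set w := ctxWeight 1 1 B n S with hw_def
  set W := ∑ i ∈ Finset.range (S + 1), w i with hW_def
  set X := ∑ i ∈ Finset.range (S + 1), w i * i with hX
  set Q := ∑ i ∈ Finset.range (S + 1), w i * (i : ℝ) ^ 2 with hQ
  -- Under the normalised weights this says that the variance of `i` is nonnegative.
  have hCS : X ^ 2 ≤ W * Q := by
    refine Finset.sum_sq_le_sum_mul_sum_of_sq_le_mul _ hw
      (fun i hi => mul_nonneg (hw i hi) (sq_nonneg _)) fun i _ => le_of_eq (by ring)
  have hX0 : 0 ≤ X := Finset.sum_nonneg fun i hi => mul_nonneg (hw i hi) (Nat.cast_nonneg i)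
  have e0 : ∑ i ∈ Finset.range (S + 1), w i * (1 + i) = W + X := by
    simp only [mul_add, mul_one, Finset.sum_add_distrib, hW_def, hX]
  have e1 : S * W - X ≤ B * ((n + 1) * W - X) := by
    have a1 : ∑ i ∈ Finset.range (S + 1), w i * ((S - i) * 1) = S * W - X := by
      rw [hW_def, hX, Finset.mul_sum, ← Finset.sum_sub_distrib]
      exact Finset.sum_congr rfl fun i _ => by ring
    have a2 : ∑ i ∈ Finset.range (S + 1), w i * ((n + 1 - i) * 1) = (n + 1) * W - X := by
      rw [hW_def, hX, Finset.mul_sum, ← Finset.sum_sub_distrib]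
      exact Finset.sum_congr rfl fun i _ => by ring
    rw [a1, a2] at h1
    have : 0 ≤ B * (w 0 * ((n + 1) * 1)) := by positivity
    linarith
  have e2 : S * X + S * W - Q - X = B * ((n + 1) * X - Q) := by
    have a1 : ∑ i ∈ Finset.range (S + 1), w i * ((S - i) * ((i : ℝ) + 1)) =
        S * X + S * W - Q - X := by
      rw [hW_def, hX, hQ, Finset.mul_sum, Finset.mul_sum, ← Finset.sum_add_distrib,
        ← Finset.sum_sub_distrib, ← Finset.sum_sub_distrib]
      exact Finset.sum_congr rfl fun i _ => by ring
    have a2 : ∑ i ∈ Finset.range (S + 1), w i * (((n : ℝ) + 1 - i) * i) = (n + 1) * X - Q := by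
      rw [hX, hQ, Finset.mul_sum, ← Finset.sum_sub_distrib]
      exact Finset.sum_congr rfl fun i _ => by ring
    rw [a2] at h2'
    rw [a1] at h2
    rw [h2, ← h2', mul_sub]
    simp
  rw [e0]
  set r : ℝ := 1 / √(n + 2) with hr
  have hn2 : (0 : ℝ) < n + 2 := by positivity
  have hr0 : 0 < r := by positivity
  have hr2 : r ^ 2 * (n + 2) = 1 := by
    rw [hr, div_pow, Real.sq_sqrt hn2.le, one_pow, one_div, inv_mul_cancel₀ hn2.ne']
  set x := X / W with hx
  have hx0 : 0 ≤ x := by positivity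
  have hμ : (W + X) / W / (n + 2) = (1 + x) / (n + 2) := by
    rw [hx, add_div, div_self hW.ne']
  rw [hμ]
  have f1 : S - x ≤ B * (n + 1 - x) := by
    have : X = x * W := by rw [hx]; field_simp
    rw [this] at e1
    have : (S - x) * W ≤ (B * (n + 1 - x)) * W := by linarith
    exact le_of_mul_le_mul_right this hW
  have f2 : x * (x - S + B * (n + 1 - x)) ≤ S - x := by
    have hXx : X = x * W := by rw [hx]; field_simp
    have hq : x ^ 2 * W ≤ Q := by
      rw [hXx] at hCS
      have : (x ^ 2 * W) * W ≤ Q * W := by linarith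
      exact le_of_mul_le_mul_right this hW
    have : (1 - B) * (x ^ 2 * W) ≤ (1 - B) * Q := by gcongr
    have h : (x * (x - S + B * (n + 1 - x))) * W ≤ (S - x) * W := by
      rw [hXx] at e2
      linarith
    exact le_of_mul_le_mul_right h hW
  set μ := (1 + x) / ((n : ℝ) + 2) with hμ'
  set a := ((S : ℝ) + 1) / (n + 2) with ha
  have hxμ : x = μ * (n + 2) - 1 := by rw [hμ']; field_simp; ring
  have hSa : (S : ℝ) = a * (n + 2) - 1 := by rw [ha]; field_simp; ring
  have hμ0 : 0 ≤ μ := by positivity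
  have g1 : a ≤ (1 - B) * μ + B := by
    rw [hxμ, hSa] at f1
    have : a * (n + 2) ≤ ((1 - B) * μ + B) * (n + 2) := by linarith
    exact le_of_mul_le_mul_right this hn2
  have g2 : μ * ((1 - B) * μ + B - a) ≤ r ^ 2 := by
    -- Adding `x - S + B * (n + 1 - x)` to both sides of `f2` leaves only `B * (n + 1 - x)` on the
    -- right.
    have h3 : (1 + x) * (x - S + B * (n + 1 - x)) ≤ n + 2 := by
      have : B * (n + 1 - x) ≤ n + 2 := by
        have : B * (n + 1 - x) ≤ B * (n + 1) := by gcongr; linarith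
        nlinarith
      linarith
    rw [hxμ, hSa] at h3
    have h4 : (μ * ((1 - B) * μ + B - a)) * (n + 2) * (n + 2) ≤ r ^ 2 * (n + 2) * (n + 2) := by
      rw [hr2]; linarith
    exact le_of_mul_le_mul_right (le_of_mul_le_mul_right h4 hn2) hn2
  exact mul_abs_sub_le_of_mul_le hB hp hr0 g1 g2

/-! ### Laws of the trials -/

/-- `P` is a law of `(x, s)` where `x` is uniform on the cube and `s` has mean `m x` given `x`. -/
structure IsTrialLaw {d : ℕ} (P : Measure (Cube d × Bool)) (m : Cube d → ℝ) : Prop where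
  isProbabilityMeasure : IsProbabilityMeasure P
  integral_eq : ∀ Y : Cube d × Bool → ℝ, Measurable Y → ∀ c : ℝ, (∀ w, |Y w| ≤ c) →
    ∫ w, Y w ∂P = ∫ x, (m x * Y (x, true) + (1 - m x) * Y (x, false))

lemma measurable_bernoulliMeasure_bool {Z : Type*} [MeasurableSpace Z] {q : Z → unitInterval}
    (hq : Measurable q) : Measurable fun z => bernoulliMeasure true false (q z) := by
  refine Measure.measurable_of_measurable_coe _ fun s hs => ?_
  classical
  have h1 : Measurable fun z => (unitInterval.toNNReal (q z) : ENNReal) := by fun_prop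
  have h2 : Measurable fun z => (unitInterval.toNNReal (unitInterval.symm (q z)) : ENNReal) := by
    fun_prop
  simp only [bernoulliMeasure_def, Measure.coe_add, Pi.add_apply, Measure.coe_nnreal_smul_apply]
  exact (h1.mul_const _).add (h2.mul_const _)

/-- The Bernoulli laws of parameter `q z`, as a kernel. -/
noncomputable def bernoulliKernel {Z : Type*} [MeasurableSpace Z] (q : Z → unitInterval)
    (hq : Measurable q) : Kernel Z Bool :=
  ⟨fun z => bernoulliMeasure true false (q z), measurable_bernoulliMeasure_bool hq⟩

instance {Z : Type*} [MeasurableSpace Z] (q : Z → unitInterval) (hq : Measurable q) :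
    IsMarkovKernel (bernoulliKernel q hq) :=
  ⟨fun z => inferInstanceAs (IsProbabilityMeasure (bernoulliMeasure true false (q z)))⟩

/-- Makes Fubini for kernels available for `trialLaw`. -/
lemma trialLaw_eq_compProd {Z : Type*} [MeasurableSpace Z] (ρ : Measure Z) [SFinite ρ]
    {q : Z → unitInterval} (hq : Measurable q) :
    trialLaw ρ q = ρ.compProd (bernoulliKernel q hq) := by
  have key : ∀ s : Set (Z × Bool), MeasurableSet s → ∀ z,
      (bernoulliMeasure true false (q z)).map (Prod.mk z) s =
        bernoulliKernel q hq z (Prod.mk z ⁻¹' s) := by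
    intro s hs z
    rw [Measure.map_apply (by fun_prop) hs]
    rfl
  ext s hs
  rw [trialLaw, Measure.bind_apply hs, Measure.compProd_apply hs]
  · simp only [key s hs]
  · refine (Measure.measurable_of_measurable_coe _ fun s hs => ?_).aemeasurable
    simp only [key s hs]
    exact Kernel.measurable_kernel_prodMk_left hs

lemma isProbabilityMeasure_trialLaw {Z : Type*} [MeasurableSpace Z] (ρ : Measure Z)
    [IsProbabilityMeasure ρ] {q : Z → unitInterval} (hq : Measurable q) :
    IsProbabilityMeasure (trialLaw ρ q) := by
  rw [trialLaw_eq_compProd ρ hq]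
  infer_instance

lemma integral_trialLaw {Z : Type*} [MeasurableSpace Z] (ρ : Measure Z) [IsProbabilityMeasure ρ]
    {q : Z → unitInterval} (hq : Measurable q) {Y : Z × Bool → ℝ} (hY : Measurable Y) {c : ℝ}
    (hc : ∀ w, |Y w| ≤ c) :
    ∫ w, Y w ∂(trialLaw ρ q) = ∫ z, ((q z : ℝ) * Y (z, true) + (1 - q z) * Y (z, false)) ∂ρ := by
  rw [trialLaw_eq_compProd ρ hq, Measure.integral_compProd]
  · refine integral_congr_ae (ae_of_all _ fun z => ?_)
    exact integral_bernoulliMeasure true false (q z) _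
  · exact Integrable.of_bound hY.aestronglyMeasurable c (ae_of_all _ hc)

lemma coe_toUnit {p : ℝ} (hp : p ∈ Set.Icc (0 : ℝ) 1) : (toUnit p : ℝ) = p := by
  rw [toUnit, Set.projIcc_of_mem _ hp]

lemma measurable_toUnit : Measurable toUnit :=
  (continuous_projIcc (h := zero_le_one (α := ℝ))).measurable

lemma isTrialLaw_trialLaw {d : ℕ} {q : Cube d → unitInterval} (hq : Measurable q)
    {m : Cube d → ℝ} (hm : ∀ x, (q x : ℝ) = m x) : IsTrialLaw (trialLaw volume q) m where
  isProbabilityMeasure := isProbabilityMeasure_trialLaw _ hq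
  integral_eq Y hY c hc := by simp only [integral_trialLaw volume hq hY hc, hm]

lemma noisyProb_eq {d : ℕ} (π : Cube d → unitInterval) (B e : ℝ) (x : Cube d) :
    noisyProb π B e x = ((1 - B) * π x + B) + (1 - π x) * e := by
  unfold noisyProb
  ring

/-- Centred noise averages out. -/
lemma isTrialLaw_noisy {d : ℕ} {π : Cube d → unitInterval} (hπ : Measurable π) {B : ℝ}
    {ν : Measure ℝ} [IsProbabilityMeasure ν] (hν : Integrable (fun e => e) ν)
    (hν0 : ∫ e, e ∂ν = 0)
    (h01 : ∀ᵐ e ∂ν, ∀ x, noisyProb π B e x ∈ Set.Icc (0 : ℝ) 1) :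
    IsTrialLaw ((trialLaw ((volume : Measure (Cube d)).prod ν)
      (fun z => toUnit (noisyProb π B z.2 z.1))).map (fun w => (w.1.1, w.2)))
      (fun x => (1 - B) * π x + B) := by
  have hq : Measurable fun z : Cube d × ℝ => toUnit (noisyProb π B z.2 z.1) := by
    refine measurable_toUnit.comp ?_
    simp only [noisyProb]
    fun_prop
  have hprob := isProbabilityMeasure_trialLaw ((volume : Measure (Cube d)).prod ν) hq
  have hmeas : Measurable fun w : (Cube d × ℝ) × Bool => (w.1.1, w.2) := by fun_prop
  refine ⟨Measure.isProbabilityMeasure_map hmeas.aemeasurable, fun Y hY c hc => ?_⟩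
  rw [integral_map hmeas.aemeasurable hY.aestronglyMeasurable,
    integral_trialLaw _ hq (Y := fun w => Y (w.1.1, w.2)) (hY.comp hmeas) (c := c)
      (fun w => hc _), integral_prod]
  · refine integral_congr_ae (ae_of_all _ fun x => ?_)
    -- Almost surely no clipping occurs, so the integrand is affine in `e` and only the mean of the
    -- noise enters.
    have : ∀ᵐ e ∂ν, ((toUnit (noisyProb π B e x) : ℝ) * Y (x, true) +
        (1 - toUnit (noisyProb π B e x)) * Y (x, false)) =
        (((1 - B) * π x + B) * Y (x, true) + (1 - ((1 - B) * π x + B)) * Y (x, false)) +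
          (1 - π x) * (Y (x, true) - Y (x, false)) * e := by
      filter_upwards [h01] with e he
      rw [coe_toUnit (he x), noisyProb_eq]
      ring
    dsimp only
    rw [integral_congr_ae this, integral_add (integrable_const _) (hν.const_mul _),
      integral_const_mul, hν0]
    simp
  · refine Integrable.of_bound (C := 2 * c) (Measurable.aestronglyMeasurable ?_)
      (ae_of_all _ fun z => ?_)
    · have h1 : Measurable fun z : Cube d × ℝ => Y (z.1, true) := hY.comp (by fun_prop)
      have h2 : Measurable fun z : Cube d × ℝ => Y (z.1, false) := hY.comp (by fun_prop)
      have h3 : Measurable fun z : Cube d × ℝ => (toUnit (noisyProb π B z.2 z.1) : ℝ) :=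
        measurable_subtype_coe.comp hq
      exact (h3.mul h1).add ((measurable_const.sub h3).mul h2)
    · have hc0 : 0 ≤ c := (abs_nonneg _).trans (hc (z.1, true))
      have h0 := (toUnit (noisyProb π B z.2 z.1)).2.1
      have h1 := (toUnit (noisyProb π B z.2 z.1)).2.2
      rw [Real.norm_eq_abs]
      refine (abs_add_le _ _).trans ?_
      rw [abs_mul, abs_mul, two_mul, abs_of_nonneg h0, abs_of_nonneg (sub_nonneg.2 h1)]
      exact add_le_add
        ((mul_le_mul h1 (hc _) (abs_nonneg _) zero_le_one).trans_eq (one_mul c))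
        ((mul_le_mul (by linarith) (hc _) (abs_nonneg _) zero_le_one).trans_eq (one_mul c))

/-! ### Deviation of sums of independent variables -/

/-- Variances of independent terms add up to at most `T`; integrating `|u| ≤ u ^ 2 / (2 √T) + √T /
2` turns this into a bound on the first moment. -/
lemma integral_abs_sum_pi_le {t : ℕ} {Ω : Type*} [MeasurableSpace Ω] (P : Fin t → Measure Ω)
    [∀ i, IsProbabilityMeasure (P i)] {Y : Fin t → Ω → ℝ} (hY : ∀ i, Measurable (Y i))
    (h1 : ∀ i w, |Y i w| ≤ 1) (h0 : ∀ i, ∫ w, Y i w ∂(P i) = 0) {q T : ℝ}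
    (hq : ∀ i, ∫ w, Y i w ^ 2 ∂(P i) ≤ q) (hT : T = t * q) (hTpos : 0 < T) :
    Integrable (fun D : Fin t → Ω => |∑ i, Y i (D i)|) (Measure.pi P) ∧
      ∫ D, |∑ i, Y i (D i)| ∂(Measure.pi P) ≤ √T := by
  have hmeas : Measurable fun D : Fin t → Ω => ∑ i, Y i (D i) :=
    Finset.measurable_sum _ fun i _ => (hY i).comp (measurable_pi_apply i)
  have hb : ∀ D : Fin t → Ω, |∑ i, Y i (D i)| ≤ t := fun D =>
    (Finset.abs_sum_le_sum_abs _ _).trans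
      ((Finset.sum_le_sum fun i _ => h1 i (D i)).trans (by simp))
  have hint : Integrable (fun D : Fin t → Ω => |∑ i, Y i (D i)|) (Measure.pi P) :=
    Integrable.of_bound hmeas.abs.aestronglyMeasurable t
      (ae_of_all _ fun D => by rw [Real.norm_eq_abs, abs_abs]; exact hb D)
  have hint2 : Integrable (fun D : Fin t → Ω => (∑ i, Y i (D i)) ^ 2) (Measure.pi P) :=
    Integrable.of_bound (hmeas.pow_const 2).aestronglyMeasurable ((t : ℝ) ^ 2)
      (ae_of_all _ fun D => by
        rw [Real.norm_eq_abs, abs_pow]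
        exact pow_le_pow_left₀ (abs_nonneg _) (hb D) 2)
  have hLp : ∀ i, MemLp (Y i) 2 (P i) := fun i =>
    MemLp.of_bound (hY i).aestronglyMeasurable 1 (ae_of_all _ fun w => h1 i w)
  refine ⟨hint, ?_⟩
  have hmean : ∫ D, ∑ i, Y i (D i) ∂(Measure.pi P) = 0 := by
    rw [integral_finsetSum]
    · refine Finset.sum_eq_zero fun i _ => ?_
      rw [integral_comp_eval (μ := P) (i := i) (f := Y i) (hY i).aestronglyMeasurable, h0]
    · exact fun i _ => integrable_comp_eval (μ := P) (i := i) (f := Y i)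
        ((hLp i).integrable (by norm_num))
  have hsq : ∫ D, (∑ i, Y i (D i)) ^ 2 ∂(Measure.pi P) ≤ T := by
    have hv := variance_sum_pi (μ := P) hLp
    rw [variance_eq_integral (by simpa [Finset.sum_fn] using hmeas.aemeasurable)] at hv
    simp only [Finset.sum_apply, hmean, sub_zero] at hv
    rw [hv, hT]
    calc ∑ i, variance (Y i) (P i) ≤ ∑ _i : Fin t, q := by
          refine Finset.sum_le_sum fun i _ => ?_
          rw [variance_eq_integral (hY i).aemeasurable, h0]
          simpa using hq i
      _ = t * q := by simp
  have hs : 0 < √T := Real.sqrt_pos.2 hTpos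
  have hss : √T * √T = T := Real.mul_self_sqrt hTpos.le
  calc ∫ D, |∑ i, Y i (D i)| ∂(Measure.pi P)
      ≤ ∫ D, ((∑ i, Y i (D i)) ^ 2 / (2 * √T) + √T / 2) ∂(Measure.pi P) := by
        refine integral_mono hint ((hint2.div_const _).add (integrable_const _)) fun D => ?_
        have : ∀ u : ℝ, |u| ≤ u ^ 2 / (2 * √T) + √T / 2 := fun u => by
          rw [div_add_div _ _ (by positivity) two_ne_zero, le_div_iff₀ (by positivity)]
          nlinarith [sq_nonneg (|u| - √T), sq_abs u]
        exact this _
    _ = (∫ D, (∑ i, Y i (D i)) ^ 2 ∂(Measure.pi P)) / (2 * √T) + √T / 2 := by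
        rw [integral_add (hint2.div_const _) (integrable_const _), integral_div]
        simp
    _ ≤ T / (2 * √T) + √T / 2 := by gcongr
    _ = √T := by
        nth_rewrite 1 [← hss]
        field_simp
        norm_num

/-! ### Geometry of the cube -/

lemma Seminorm.le_mul_norm_pi {d : ℕ} (N : Seminorm ℝ (Fin d → ℝ)) (v : Fin d → ℝ) :
    N v ≤ (∑ j, N (Pi.single j 1)) * ‖v‖ := by
  have hv : v = ∑ j, v j • (Pi.single j 1 : Fin d → ℝ) := by
    ext k
    simp [Finset.sum_apply, Pi.single_apply]
  calc N v = N (∑ j, v j • (Pi.single j 1 : Fin d → ℝ)) := by rw [← hv]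
    _ ≤ ∑ j, N (v j • (Pi.single j 1 : Fin d → ℝ)) :=
        Finset.le_sum_of_subadditive N (map_zero N).le (map_add_le_add N) _ _
    _ ≤ ∑ j, N (Pi.single j 1) * ‖v‖ := by
        refine Finset.sum_le_sum fun j _ => ?_
        rw [map_smul_eq_mul, mul_comm]
        gcongr
        exact norm_le_pi_norm v j
    _ = _ := (Finset.sum_mul _ _ _).symm

lemma cubeDist_nonneg {d : ℕ} (N : Seminorm ℝ (Fin d → ℝ)) (x y : Cube d) : 0 ≤ cubeDist N x y :=
  apply_nonneg N _

lemma continuous_seminorm_pi {d : ℕ} (N : Seminorm ℝ (Fin d → ℝ)) : Continuous N := by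
  have hA : 0 ≤ ∑ j, N (Pi.single j 1) := Finset.sum_nonneg fun j _ => apply_nonneg N _
  refine (LipschitzWith.of_dist_le_mul (K := ⟨_, hA⟩) fun u v => ?_).continuous
  rw [Real.dist_eq, dist_eq_norm]
  exact (Seminorm.norm_sub_map_le_sub N u v).trans (N.le_mul_norm_pi _)

lemma continuous_cubeDist {d : ℕ} (N : Seminorm ℝ (Fin d → ℝ)) (x : Cube d) :
    Continuous fun y => cubeDist N x y :=
  (continuous_seminorm_pi N).comp (by fun_prop)

lemma IsLipschitz.abs {d : ℕ} {N : Seminorm ℝ (Fin d → ℝ)} {L : ℝ} {π : Cube d → unitInterval}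
    (h : IsLipschitz N L π) : IsLipschitz N |L| π := fun x y =>
  (h x y).trans (mul_le_mul_of_nonneg_right (le_abs_self L) (cubeDist_nonneg N x y))

lemma IsLipschitz.measurable {d : ℕ} {N : Seminorm ℝ (Fin d → ℝ)} {L : ℝ}
    {π : Cube d → unitInterval} (h : IsLipschitz N L π) : Measurable π := by
  refine Continuous.measurable (continuous_iff_continuousAt.2 fun x => ?_)
  rw [ContinuousAt, tendsto_iff_dist_tendsto_zero]
  have h0 : cubeDist N x x = 0 := by
    simp only [cubeDist, sub_self]
    exact map_zero N
  have := ((continuous_cubeDist N x).tendsto x).const_mul L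
  rw [h0, mul_zero] at this
  refine squeeze_zero (fun y => dist_nonneg) (fun y => ?_) this
  rw [dist_comm, Subtype.dist_eq, Real.dist_eq]
  exact h x y

/-- The experiment points that count as neighbours of `x`. -/
def cubeBall {d : ℕ} (N : Seminorm ℝ (Fin d → ℝ)) (Δ : ℝ) (x : Cube d) : Set (Cube d) :=
  {y | cubeDist N x y ≤ Δ}

lemma measurableSet_cubeBall {d : ℕ} (N : Seminorm ℝ (Fin d → ℝ)) (Δ : ℝ) (x : Cube d) :
    MeasurableSet (cubeBall N Δ x) :=
  measurableSet_le (continuous_cubeDist N x).measurable measurable_const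

/-- The ball contains a box of half-side `r = Δ / A` clipped to the cube. Since `r ≤ 1`, clipping
leaves every side of length at least `r`, even at a corner. -/
lemma pow_le_volume_cubeBall {d : ℕ} (N : Seminorm ℝ (Fin d → ℝ)) {A : ℝ} (hA : 0 < A)
    (hN : ∀ v, N v ≤ A * ‖v‖) {Δ : ℝ} (hΔ : 0 ≤ Δ) (hΔA : Δ ≤ A) (x : Cube d) :
    (Δ / A) ^ d ≤ volume.real (cubeBall N Δ x) := by
  have hr0 : 0 ≤ Δ / A := by positivity
  have hr1 : Δ / A ≤ 1 := (div_le_one hA).2 hΔA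
  set r := Δ / A with hr
  have hsub : Set.pi Set.univ (fun j => Set.Icc (toUnit (x j - r)) (toUnit (x j + r))) ⊆
      cubeBall N Δ x := by
    intro y hy
    have hy' : ‖fun j => (x j : ℝ) - (y j : ℝ)‖ ≤ r := by
      rw [pi_norm_le_iff_of_nonneg hr0]
      intro j
      have h1 : (toUnit (x j - r) : ℝ) ≤ y j := (hy j trivial).1
      have h2 : (y j : ℝ) ≤ toUnit (x j + r) := (hy j trivial).2
      have h3 := (x j).2.1
      have h4 := (x j).2.2
      simp only [toUnit, Set.coe_projIcc] at h1 h2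
      rw [min_eq_right (by linarith)] at h1
      have h5 : (x j : ℝ) - r ≤ y j := (le_max_right _ _).trans h1
      have h6 : (y j : ℝ) ≤ x j + r :=
        h2.trans (max_le (by linarith) (min_le_right _ _))
      rw [Real.norm_eq_abs, abs_le]
      constructor <;> linarith
    calc cubeDist N x y ≤ A * ‖fun j => (x j : ℝ) - (y j : ℝ)‖ := hN _
      _ ≤ A * r := by gcongr
      _ = Δ := by rw [hr]; field_simp
  refine le_trans ?_ (measureReal_mono hsub)
  rw [measureReal_def, volume_pi_pi, ENNReal.toReal_prod]
  calc r ^ d = ∏ _j : Fin d, r := by simp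
    _ ≤ _ := by
      refine Finset.prod_le_prod (fun _ _ => hr0) fun j _ => ?_
      have h3 := (x j).2.1
      have h4 := (x j).2.2
      rw [unitInterval.volume_Icc, ENNReal.toReal_ofReal']
      refine le_max_of_le_left ?_
      simp only [toUnit, Set.coe_projIcc]
      rw [min_eq_right (by linarith : (x j : ℝ) - r ≤ 1),
        max_eq_right (le_min zero_le_one (by linarith))]
      rcases le_total (1 : ℝ) (x j + r) with h | h <;>
        rcases le_total (0 : ℝ) (x j - r) with h' | h'
      · rw [min_eq_left h, max_eq_right h']; linarith
      · rw [min_eq_left h, max_eq_left h']; linarith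
      · rw [min_eq_right h, max_eq_right h']; linarith
      · rw [min_eq_right h, max_eq_left h']; linarith

lemma width_pos {d t : ℕ} {κ : ℝ} (hκ : 0 < κ) (ht : 1 ≤ t) : 0 < width d t κ := by
  have : (0 : ℝ) < t := by exact_mod_cast ht
  unfold width
  positivity

lemma rate_le_one {d t : ℕ} (ht : 1 ≤ t) : (t : ℝ) ^ (-(1 / ((d : ℝ) + 2))) ≤ 1 :=
  Real.rpow_le_one_of_one_le_of_nonpos (by exact_mod_cast ht) (by
    rw [neg_nonpos]; positivity)

/-- The balance behind the kernel width: `t Δ ^ d` is of order `Δ ^ (-2)`, so bias and standard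
deviation have the same order. -/
lemma mul_rate_pow {d t : ℕ} (ht : 1 ≤ t) :
    (t : ℝ) * ((t : ℝ) ^ (-(1 / ((d : ℝ) + 2)))) ^ (d + 2) = 1 := by
  have ht0 : (0 : ℝ) < t := by exact_mod_cast ht
  rw [← Real.rpow_natCast, ← Real.rpow_mul ht0.le]
  push_cast
  rw [show -(1 / ((d : ℝ) + 2)) * (d + 2) = -1 by field_simp, Real.rpow_neg_one,
    mul_inv_cancel₀ ht0.ne']

/-- The expected number of neighbours is at least of the order of `t^{2/(d+2)}`. -/
lemma inv_sqrt_expected_neighbors_le {d t : ℕ} (N : Seminorm ℝ (Fin d → ℝ)) {A κ : ℝ} (hκ : 0 < κ)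
    (hA : κ ≤ A) (hN : ∀ v, N v ≤ A * ‖v‖) (ht : 1 ≤ t) (x : Cube d) :
    0 < t * volume.real (cubeBall N (width d t κ) x) ∧
      1 / √(t * volume.real (cubeBall N (width d t κ) x)) ≤
        1 / √((κ / A) ^ d) * (t : ℝ) ^ (-(1 / ((d : ℝ) + 2))) := by
  have hA0 : 0 < A := hκ.trans_le hA
  have ht0 : (0 : ℝ) < t := by exact_mod_cast ht
  set τ := (t : ℝ) ^ (-(1 / ((d : ℝ) + 2))) with hτ
  have hτ0 : 0 < τ := by positivity
  have hτ1 : τ ≤ 1 := rate_le_one ht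
  have hw : width d t κ = κ * τ := rfl
  have hvol := pow_le_volume_cubeBall N hA0 hN (width_pos (d := d) hκ ht).le
    (by rw [hw]; exact (mul_le_of_le_one_right hκ.le hτ1).trans hA) x
  set q := volume.real (cubeBall N (width d t κ) x)
  set c := (κ / A) ^ d with hc
  have hc0 : 0 < c := by positivity
  have hT : c ≤ (t * q) * τ ^ 2 := by
    calc c = c * (t * τ ^ (d + 2)) := by rw [mul_rate_pow ht, mul_one]
      _ = t * (κ * τ / A) ^ d * τ ^ 2 := by rw [hc, div_pow, div_pow]; ring
      _ ≤ t * q * τ ^ 2 := by rw [← hw]; gcongr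
  have hTpos : 0 < t * q := by
    by_contra! h
    have : (t * q) * τ ^ 2 ≤ 0 := mul_nonpos_of_nonpos_of_nonneg h (by positivity)
    linarith
  refine ⟨hTpos, ?_⟩
  have h1 : √c ≤ √(t * q) * τ := by
    rw [← Real.sqrt_mul_self hτ0.le, ← Real.sqrt_mul hTpos.le, ← sq]
    exact Real.sqrt_le_sqrt hT
  have h2 : 0 < √c := Real.sqrt_pos.2 hc0
  have h3 : 0 < √(t * q) := Real.sqrt_pos.2 hTpos
  rw [div_mul_eq_mul_div, one_mul, div_le_div_iff₀ h3 h2, one_mul]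
  linarith

/-! ### The risk of plug-in classification -/

lemma risk_true (p : unitInterval) : risk p true = 1 - p := by
  unfold risk
  rw [bernoulliMeasure_real_apply_of_notMem_of_mem p (by measurability) (by simp) (by simp)]

lemma risk_false (p : unitInterval) : risk p false = p := by
  unfold risk
  rw [bernoulliMeasure_real_apply_of_mem_of_notMem p (by measurability) (by simp) (by simp)]

lemma risk_mem_Icc (p : unitInterval) (b : Bool) : risk p b ∈ Set.Icc (0 : ℝ) 1 := by
  have h0 := p.2.1
  have h1 := p.2.2
  cases b
  · rw [risk_false]; exact ⟨h0, h1⟩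
  · rw [risk_true]; constructor <;> linarith

/-- A wrong class costs `|1 - 2 p|`, and requires the posterior mean and `p` to lie on opposite
sides of `1 / 2`. -/
lemma risk_plugIn_sub_le (p : unitInterval) (ρ : Measure ℝ) :
    risk p (plugIn ρ) - min (p : ℝ) (1 - p) ≤ 2 * |∫ θ, θ ∂ρ - p| := by
  have h1 := le_abs_self (∫ θ, θ ∂ρ - p)
  have h2 := neg_le_abs (∫ θ, θ ∂ρ - p)
  have h3 := abs_nonneg (∫ θ, θ ∂ρ - p)
  by_cases h : 1 / 2 ≤ ∫ θ, θ ∂ρ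
  · rw [plugIn, decide_eq_true h, risk_true]
    rcases min_cases (p : ℝ) (1 - p) with ⟨h4, _⟩ | ⟨h4, _⟩ <;> rw [h4] <;> linarith
  · rw [plugIn, decide_eq_false h, risk_false]
    push Not at h
    rcases min_cases (p : ℝ) (1 - p) with ⟨h4, _⟩ | ⟨h4, _⟩ <;> rw [h4] <;> linarith

/-- The indices of the successful experiments. -/
def successSet {d t : ℕ} (D : DataSet d t) : Finset (Fin t) :=
  Finset.univ.filter fun i => (D i).2 = true

lemma mem_neighbors {d t : ℕ} (N : Seminorm ℝ (Fin d → ℝ)) (Δ : ℝ) (D : DataSet d t) (x : Cube d)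
    (i : Fin t) : i ∈ neighbors N Δ D x ↔ cubeDist N x (D i).1 ≤ Δ := by
  simp [neighbors]

lemma successes_eq {d t : ℕ} (D : DataSet d t) (s : Finset (Fin t)) :
    successes D s = (s ∩ successSet D).card := by
  rw [successes, successSet, Finset.inter_filter, Finset.inter_univ]

lemma successes_le_card {d t : ℕ} (D : DataSet d t) (s : Finset (Fin t)) :
    successes D s ≤ s.card := Finset.card_filter_le _ _

/-- Functions of the sets of neighbours and successes are measurable. -/
lemma measurable_of_neighbors {d t : ℕ} (N : Seminorm ℝ (Fin d → ℝ)) (Δ : ℝ) (x : Cube d)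
    (G : Finset (Fin t) → Finset (Fin t) → Bool) :
    Measurable fun D : DataSet d t => G (neighbors N Δ D x) (successSet D) := by
  refine measurable_to_countable' fun b => ?_
  have : (fun D : DataSet d t => G (neighbors N Δ D x) (successSet D)) ⁻¹' {b} =
      ⋃ u : Finset (Fin t), ⋃ v : Finset (Fin t), {D | neighbors N Δ D x = u} ∩
        {D | successSet D = v} ∩ {_D | G u v = b} := by
    ext D
    simp
  rw [this]
  refine MeasurableSet.iUnion fun u => MeasurableSet.iUnion fun v => ?_
  refine (MeasurableSet.inter ?_ ?_).inter (MeasurableSet.const _)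
  · have : {D : DataSet d t | neighbors N Δ D x = u} =
        ⋂ i, {D | (D i).1 ∈ cubeBall N Δ x ↔ i ∈ u} := by
      ext D
      simp [Finset.ext_iff, mem_neighbors, cubeBall]
    rw [this]
    refine MeasurableSet.iInter fun i => ?_
    have hm : Measurable fun D : DataSet d t => (D i).1 := by fun_prop
    exact (hm (measurableSet_cubeBall N Δ x)).iff (MeasurableSet.const _)
  · have : {D : DataSet d t | successSet D = v} = ⋂ i, {D | (D i).2 = true ↔ i ∈ v} := by
      ext D
      simp [Finset.ext_iff, successSet]
    rw [this]
    refine MeasurableSet.iInter fun i => ?_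
    have hm : Measurable fun D : DataSet d t => (D i).2 := by fun_prop
    exact (hm (measurableSet_singleton true)).iff (MeasurableSet.const _)

/-! ### Neighbour counts and residuals as sums over independent trials. -/

lemma card_neighbors {d t : ℕ} (N : Seminorm ℝ (Fin d → ℝ)) (Δ : ℝ) (D : DataSet d t)
    (x : Cube d) :
    ((neighbors N Δ D x).card : ℝ) = ∑ i, (cubeBall N Δ x).indicator (fun _ => (1 : ℝ)) (D i).1 := by
  classical
  rw [neighbors, Finset.card_filter]
  push_cast
  exact Finset.sum_congr rfl fun i _ => by simp [Set.indicator_apply, cubeBall]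

/-- Difference of the result and its conditional mean, at the neighbours of `x`. -/
noncomputable def neighborResidual {d : ℕ} (N : Seminorm ℝ (Fin d → ℝ)) (Δ : ℝ) (x : Cube d)
    (m : Cube d → ℝ) (w : Cube d × Bool) : ℝ :=
  (cubeBall N Δ x).indicator (fun _ => (1 : ℝ)) w.1 * ((if w.2 = true then 1 else 0) - m w.1)

lemma sum_neighborResidual {d t : ℕ} (N : Seminorm ℝ (Fin d → ℝ)) (Δ : ℝ) (D : DataSet d t)
    (x : Cube d) (m : Fin t → Cube d → ℝ) :
    ∑ i, neighborResidual N Δ x (m i) (D i) =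
      successes D (neighbors N Δ D x) - ∑ i ∈ neighbors N Δ D x, m i (D i).1 := by
  classical
  rw [successes, Finset.card_filter]
  push_cast
  rw [← Finset.sum_sub_distrib, neighbors, Finset.sum_filter]
  refine Finset.sum_congr rfl fun i _ => ?_
  simp only [neighborResidual, Set.indicator_apply, cubeBall, Set.mem_ofPred_eq, ite_mul, one_mul,
    zero_mul]

/-- The smoothed success rate compared with the success probability at `x`, for the mean context
`β` of the neighbours. -/
lemma abs_success_rate_sub_le {d t : ℕ} {N : Seminorm ℝ (Fin d → ℝ)} {L Δ : ℝ} (hL : 0 ≤ L)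
    {π : Cube d → unitInterval} (hπ : IsLipschitz N L π) (D : DataSet d t) (x : Cube d)
    {B : Fin t → ℝ} (hB : ∀ i, 0 ≤ B i ∧ B i ≤ 1) {β : ℝ} (hβ0 : 0 ≤ β) (hβ1 : β ≤ 1)
    (hβ : (neighbors N Δ D x).card * β = ∑ i ∈ neighbors N Δ D x, B i) :
    |(successes D (neighbors N Δ D x) + 1 : ℝ) / ((neighbors N Δ D x).card + 2) -
        ((1 - β) * π x + β)| * ((neighbors N Δ D x).card + 2) ≤
      |∑ i, neighborResidual N Δ x (fun y => (1 - B i) * π y + B i) (D i)| +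
        (neighbors N Δ D x).card * (L * Δ) + 1 := by
  rw [sum_neighborResidual]
  set s := neighbors N Δ D x with hs
  set S : ℝ := (successes D s : ℝ)
  have hp0 := (π x).2.1
  have hp1 := (π x).2.2
  have hn2 : (0 : ℝ) < s.card + 2 := by positivity
  have hsum : ∑ i ∈ s, ((1 - B i) * (π x : ℝ) + B i) = s.card * ((1 - β) * π x + β) := by
    have : ∀ i ∈ s, (1 - B i) * (π x : ℝ) + B i = π x + (1 - π x) * B i := fun i _ => by ring
    rw [Finset.sum_congr rfl this, Finset.sum_add_distrib, ← Finset.mul_sum, ← hβ]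
    simp
    ring
  have hbias : |∑ i ∈ s, ((1 - B i) * (π (D i).1 : ℝ) + B i) -
      ∑ i ∈ s, ((1 - B i) * (π x : ℝ) + B i)| ≤ s.card * (L * Δ) := by
    rw [← Finset.sum_sub_distrib]
    refine (Finset.abs_sum_le_sum_abs _ _).trans ?_
    rw [← nsmul_eq_mul]
    refine Finset.sum_le_card_nsmul _ _ _ fun i hi => ?_
    have h1 : |(π x : ℝ) - π (D i).1| ≤ L * Δ :=
      (hπ x (D i).1).trans (mul_le_mul_of_nonneg_left ((mem_neighbors N Δ D x i).1 hi) hL)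
    rw [show (1 - B i) * (π (D i).1 : ℝ) + B i - ((1 - B i) * π x + B i) =
      (1 - B i) * (π (D i).1 - π x) by ring, abs_mul, abs_sub_comm,
      abs_sub_comm (π (D i).1 : ℝ), abs_sub_comm, abs_of_nonneg (by linarith [(hB i).2])]
    calc (1 - B i) * |(π x : ℝ) - π (D i).1| ≤ 1 * |(π x : ℝ) - π (D i).1| := by
          gcongr; linarith [(hB i).1]
      _ ≤ L * Δ := by rw [one_mul]; exact h1
  rw [hsum] at hbias
  -- The contribution of the uniform prior: one extra success in two extra tests.
  have hprior : |1 - 2 * ((1 - β) * (π x : ℝ) + β)| ≤ 1 := by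
    have h1 : 0 ≤ (1 - β) * (π x : ℝ) := mul_nonneg (by linarith) hp0
    have h2 : (1 - β) * (π x : ℝ) ≤ (1 - β) * 1 := by gcongr
    rw [abs_le]
    constructor <;> linarith
  rw [← abs_of_pos hn2, ← abs_mul, abs_of_pos hn2, sub_mul, div_mul_cancel₀ _ hn2.ne']
  set R := ∑ i ∈ s, ((1 - B i) * (π (D i).1 : ℝ) + B i)
  rw [show S + 1 - ((1 - β) * (π x : ℝ) + β) * (s.card + 2) =
    (S - R) + (R - s.card * ((1 - β) * π x + β)) + (1 - 2 * ((1 - β) * (π x : ℝ) + β)) by ring]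
  exact (abs_add_three _ _ _).trans (by gcongr)

/-- Either the number `n` of neighbours is at least half of its expectation `T`, or it deviates
much from it. -/
lemma excess_le {n T a δ M E A : ℝ} (hn : 0 ≤ n) (hT : 0 < T) (hA : 2 ≤ A) (hδ : 0 ≤ δ)
    (hE1 : E ≤ 1) (hE : E ≤ A * (|a| + 1 / √(n + 2))) (h : |a| * (n + 2) ≤ |M| + n * δ + 1) :
    E ≤ A * (δ + 2 / T * |M| + 4 / √T + 1 / T * |n - T|) := by
  have hsT : 0 < √T := Real.sqrt_pos.2 hT
  rcases le_or_gt (T / 2) n with hnT | hnT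
  · have hn2 : 0 < n + 2 := by linarith
    have hs : 0 < √(n + 2) := Real.sqrt_pos.2 hn2
    have h1 : 1 / √(n + 2) ≤ 2 / √T := by
      rw [div_le_div_iff₀ hs hsT, one_mul]
      refine abs_le_of_sq_le_sq' ?_ (by positivity) |>.2
      rw [mul_pow, Real.sq_sqrt hT.le, Real.sq_sqrt hn2.le]
      linarith
    have h2 : 1 / (n + 2) ≤ 1 / √(n + 2) := by
      apply one_div_le_one_div_of_le hs
      rw [Real.sqrt_le_left hn2.le]
      nlinarith
    have h3 : |a| ≤ (|M| + n * δ + 1) / (n + 2) := (le_div_iff₀ hn2).2 h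
    have h4 : (|M| + n * δ + 1) / (n + 2) ≤ 2 / T * |M| + δ + 1 / (n + 2) := by
      rw [add_div, add_div]
      gcongr ?_ + ?_ + ?_
      · rw [div_mul_eq_mul_div, div_le_div_iff₀ hn2 hT]
        nlinarith [abs_nonneg M]
      · rw [div_le_iff₀ hn2]
        nlinarith
      · exact le_rfl
    refine hE.trans (mul_le_mul_of_nonneg_left ?_ (by linarith))
    have h5 : 0 ≤ 1 / T * |n - T| := by positivity
    have h6 : 4 / √T = 2 / √T + 2 / √T := by ring
    linarith
  -- Too few neighbours: the deviation term is at least `1 / 2`, and `2 ≤ A` makes the right side at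
  -- least `1 ≥ E`.
  · have h1 : 1 / 2 ≤ 1 / T * |n - T| := by
      rw [one_div_mul_eq_div, le_div_iff₀ hT]
      have := neg_le_abs (n - T)
      linarith
    have h2 : 0 ≤ δ + 2 / T * |M| + 4 / √T := by positivity
    have h3 : 2 * (1 / 2) ≤ A * (δ + 2 / T * |M| + 4 / √T + 1 / T * |n - T|) := by
      gcongr
      linarith
    linarith

/-! ### Moments under a single trial law, and the main estimate. -/

lemma IsTrialLaw.integral_fst {d : ℕ} {P : Measure (Cube d × Bool)} {m : Cube d → ℝ}
    (hP : IsTrialLaw P m) {g : Cube d → ℝ} (hg : Measurable g) {c : ℝ} (hc : ∀ x, |g x| ≤ c) :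
    ∫ w, g w.1 ∂P = ∫ x, g x := by
  rw [hP.integral_eq (fun w => g w.1) (by fun_prop) c fun w => hc _]
  exact integral_congr_ae (ae_of_all _ fun x => by ring)

lemma measurable_indicator_cubeBall {d : ℕ} (N : Seminorm ℝ (Fin d → ℝ)) (Δ : ℝ) (x : Cube d) :
    Measurable ((cubeBall N Δ x).indicator fun _ => (1 : ℝ)) :=
  measurable_const.indicator (measurableSet_cubeBall N Δ x)

lemma indicator_one_cases {X : Type*} (s : Set X) (x : X) :
    s.indicator (fun _ => (1 : ℝ)) x = 0 ∨ s.indicator (fun _ => (1 : ℝ)) x = 1 := by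
  by_cases h : x ∈ s <;> simp [h]

lemma IsTrialLaw.integral_indicator {d : ℕ} {P : Measure (Cube d × Bool)} {m : Cube d → ℝ}
    (hP : IsTrialLaw P m) (N : Seminorm ℝ (Fin d → ℝ)) (Δ : ℝ) (x : Cube d) :
    ∫ w, (cubeBall N Δ x).indicator (fun _ => (1 : ℝ)) w.1 ∂P = volume.real (cubeBall N Δ x) := by
  rw [hP.integral_fst (measurable_indicator_cubeBall N Δ x) (c := 1),
    MeasureTheory.integral_indicator (measurableSet_cubeBall N Δ x)]
  · simp
  · intro y
    rcases indicator_one_cases (cubeBall N Δ x) y with h | h <;> simp [h]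

lemma IsTrialLaw.integrable_indicator {d : ℕ} {P : Measure (Cube d × Bool)} {m : Cube d → ℝ}
    (hP : IsTrialLaw P m) (N : Seminorm ℝ (Fin d → ℝ)) (Δ : ℝ) (x : Cube d) :
    Integrable (fun w => (cubeBall N Δ x).indicator (fun _ => (1 : ℝ)) w.1) P := by
  have := hP.isProbabilityMeasure
  refine Integrable.of_bound (C := 1)
    ((measurable_indicator_cubeBall N Δ x).comp measurable_fst).aestronglyMeasurable
    (ae_of_all _ fun w => ?_)
  rcases indicator_one_cases (cubeBall N Δ x) w.1 with h | h <;> simp [h]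

lemma measurable_neighborResidual {d : ℕ} (N : Seminorm ℝ (Fin d → ℝ)) (Δ : ℝ) (x : Cube d)
    {m : Cube d → ℝ} (hm : Measurable m) : Measurable (neighborResidual N Δ x m) := by
  unfold neighborResidual
  have h1 : Measurable fun w : Cube d × Bool => (cubeBall N Δ x).indicator (fun _ => (1 : ℝ)) w.1 :=
    (measurable_indicator_cubeBall N Δ x).comp measurable_fst
  have h2 : Measurable fun w : Cube d × Bool => if w.2 = true then (1 : ℝ) else 0 :=
    Measurable.ite (measurable_snd (measurableSet_singleton true)) measurable_const measurable_const
  exact h1.mul (h2.sub (hm.comp measurable_fst))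

lemma abs_neighborResidual_le {d : ℕ} (N : Seminorm ℝ (Fin d → ℝ)) (Δ : ℝ) (x : Cube d)
    {m : Cube d → ℝ} (hm : ∀ y, m y ∈ Set.Icc (0 : ℝ) 1) (w : Cube d × Bool) :
    |neighborResidual N Δ x m w| ≤ (cubeBall N Δ x).indicator (fun _ => (1 : ℝ)) w.1 := by
  have h0 := (hm w.1).1
  have h1 := (hm w.1).2
  have h : |(if w.2 = true then (1 : ℝ) else 0) - m w.1| ≤ 1 := by
    rw [abs_le]
    split_ifs <;> constructor <;> linarith
  unfold neighborResidual
  rcases indicator_one_cases (cubeBall N Δ x) w.1 with h' | h' <;> simp only [h']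
  · simp
  · simpa using h

lemma integrable_and_integral_affine {Ω : Type*} [MeasurableSpace Ω] {μ : Measure Ω}
    [IsProbabilityMeasure μ] {f g : Ω → ℝ} (hf : Integrable f μ) (hg : Integrable g μ)
    (a F c u e v : ℝ) :
    Integrable (fun ω => a + F * (c + u * f ω + e + v * g ω)) μ ∧
      ∫ ω, (a + F * (c + u * f ω + e + v * g ω)) ∂μ =
        a + F * (c + u * ∫ ω, f ω ∂μ + e + v * ∫ ω, g ω ∂μ) := by
  have h1 : ∀ ω, a + F * (c + u * f ω + e + v * g ω) =
      (a + F * (c + e)) + (F * u * f ω + F * v * g ω) := fun ω => by ring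
  have hf' := hf.const_mul (F * u)
  have hg' := hg.const_mul (F * v)
  have hfg : Integrable (fun ω => F * u * f ω + F * v * g ω) μ := hf'.add hg'
  simp only [h1]
  refine ⟨(integrable_const _).add hfg, ?_⟩
  rw [integral_add (integrable_const _) hfg, integral_add hf' hg', integral_const_mul,
    integral_const_mul]
  simp
  ring

/-- A plug-in classification whose posterior mean is governed by the smoothed success rate
attains the Bayes risk up to `O(t^{-1/(d+2)})`. -/
theorem expectedRiskLE_plugIn {d t : ℕ} (N : Seminorm ℝ (Fin d → ℝ)) {L κ A b : ℝ} (hL : 0 ≤ L)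
    (hκ : 0 < κ) (hA : κ ≤ A) (hN : ∀ v, N v ≤ A * ‖v‖) (hb0 : 0 ≤ b) (hb1 : b < 1) (ht : 1 ≤ t)
    {π : Cube d → unitInterval} (hπ : IsLipschitz N L π) {B : Fin t → ℝ}
    (hB : ∀ i, 0 ≤ B i ∧ B i ≤ b) {P : Fin t → Measure (Cube d × Bool)}
    (hP : ∀ i, IsTrialLaw (P i) fun y => (1 - B i) * π y + B i) (x : Cube d)
    (ρ : DataSet d t → Measure ℝ) (hρ : Measurable fun D => plugIn (ρ D))
    (h : ∀ D, ∃ β : ℝ, 0 ≤ β ∧ β ≤ 1 ∧ (neighbors N (width d t κ) D x).card * β =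
        ∑ i ∈ neighbors N (width d t κ) D x, B i ∧
      (1 - b) * |∫ θ, θ ∂(ρ D) - π x| ≤
        |(successes D (neighbors N (width d t κ) D x) + 1 : ℝ) /
            ((neighbors N (width d t κ) D x).card + 2) - ((1 - β) * π x + β)| +
          1 / √((neighbors N (width d t κ) D x).card + 2)) :
    ExpectedRiskLE (Measure.pi P) (π x) (fun D => plugIn (ρ D))
      ((2 / (1 - b) * (L * κ + 7 * (1 / √((κ / A) ^ d)))) *
        (t : ℝ) ^ (-(1 / ((d : ℝ) + 2)))) := by
  have hprob := fun i => (hP i).isProbabilityMeasure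
  obtain ⟨hTpos, hTinv⟩ := inv_sqrt_expected_neighbors_le N hκ hA hN ht x
  have hΔ := (width_pos (d := d) hκ ht).le
  have hw : width d t κ = κ * (t : ℝ) ^ (-(1 / ((d : ℝ) + 2))) := rfl
  set τ := (t : ℝ) ^ (-(1 / ((d : ℝ) + 2))) with hτ
  set Δ := width d t κ with hΔdef
  set q := volume.real (cubeBall N Δ x) with hq
  set T := t * q with hT
  set I : Cube d → ℝ := (cubeBall N Δ x).indicator fun _ => (1 : ℝ) with hI
  set m : Fin t → Cube d → ℝ := fun i y => (1 - B i) * π y + B i with hm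
  have hmm : ∀ i, Measurable (m i) := fun i => by
    have := hπ.measurable
    simp only [hm]
    fun_prop
  have hm01 : ∀ i y, m i y ∈ Set.Icc (0 : ℝ) 1 := fun i y => by
    have h0 := (π y).2.1
    have h1 := (π y).2.2
    have h2 := (hB i).1
    have h3 : 0 ≤ 1 - B i := by linarith [(hB i).2]
    have h4 : (1 - B i) * (π y : ℝ) ≤ (1 - B i) * 1 := by gcongr
    exact ⟨by positivity, by simp only [hm]; linarith⟩
  have hI01 : ∀ y, 0 ≤ I y ∧ I y ≤ 1 := fun y => by
    rcases indicator_one_cases (cubeBall N Δ x) y with h | h <;> simp [hI, h]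
  have hIm : Measurable I := measurable_indicator_cubeBall N Δ x
  have hIint : ∀ i, Integrable (fun w : Cube d × Bool => I w.1) (P i) :=
    fun i => (hP i).integrable_indicator N Δ x
  have hIval : ∀ i, ∫ w, I w.1 ∂(P i) = q := fun i => (hP i).integral_indicator N Δ x
  have hres1 : ∀ i w, |neighborResidual N Δ x (m i) w| ≤ 1 := fun i w =>
    (abs_neighborResidual_le N Δ x (hm01 i) w).trans (hI01 _).2
  obtain ⟨hMint, hMle⟩ := integral_abs_sum_pi_le P (Y := fun i => neighborResidual N Δ x (m i))
    (fun i => measurable_neighborResidual N Δ x (hmm i)) hres1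
    (fun i => by
      rw [(hP i).integral_eq _ (measurable_neighborResidual N Δ x (hmm i)) 1 (hres1 i)]
      rw [← integral_zero (Cube d) ℝ]
      refine integral_congr_ae (ae_of_all _ fun y => ?_)
      simp only [neighborResidual, if_true, Bool.false_eq_true, if_false]
      ring)
    (q := q) (fun i => by
      rw [← hIval i]
      refine integral_mono_of_nonneg (ae_of_all _ fun w => sq_nonneg _) (hIint i)
        (ae_of_all _ fun w => ?_)
      have h1 := abs_neighborResidual_le N Δ x (hm01 i) w
      have h2 := hres1 i w
      dsimp only
      rw [← sq_abs]
      nlinarith [abs_nonneg (neighborResidual N Δ x (m i) w)]) hT hTpos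
  have hq01 : 0 ≤ q ∧ q ≤ 1 := ⟨measureReal_nonneg, measureReal_le_one⟩
  obtain ⟨hZint, hZle⟩ := integral_abs_sum_pi_le P (Y := fun _ w => I w.1 - q)
    (fun i => by fun_prop)
    (fun i w => by
      have := hI01 w.1
      rw [abs_le]
      constructor <;> linarith)
    (fun i => by
      rw [integral_sub (hIint i) (integrable_const _), hIval]
      simp)
    (q := q) (fun i => by
      -- An indicator equals its square, so the variance is `q - q ^ 2 ≤ q`.
      have : ∀ w : Cube d × Bool, (I w.1 - q) ^ 2 = (1 - 2 * q) * I w.1 + q ^ 2 := fun w => by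
        rcases indicator_one_cases (cubeBall N Δ x) w.1 with h | h <;> simp only [hI, h] <;> ring
      simp only [this]
      rw [integral_add ((hIint i).const_mul _) (integrable_const _), integral_const_mul, hIval]
      simp
      nlinarith [hq01.1]) hT hTpos
  have hriskm : Measurable fun D => risk (π x) (plugIn (ρ D)) :=
    (measurable_of_countable (risk (π x))).comp hρ
  have hriskint : Integrable (fun D => risk (π x) (plugIn (ρ D))) (Measure.pi P) := by
    refine Integrable.of_bound (C := 1) hriskm.aestronglyMeasurable (ae_of_all _ fun D => ?_)
    have := risk_mem_Icc (π x) (plugIn (ρ D))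
    rw [Real.norm_eq_abs, abs_of_nonneg this.1]
    exact this.2
  refine ⟨hriskint, ?_⟩
  set F := 2 / (1 - b) with hF
  have hb : 0 < 1 - b := by linarith
  have hF2 : 2 ≤ F := by
    rw [hF, le_div_iff₀ hb]
    linarith
  have hp0 := (π x).2.1
  have hp1 := (π x).2.2
  have hpt : ∀ D : DataSet d t, risk (π x) (plugIn (ρ D)) ≤ min (π x : ℝ) (1 - π x) +
      F * (L * Δ + 2 / T * |∑ i, neighborResidual N Δ x (m i) (D i)| + 4 / √T +
        1 / T * |∑ i, (I (D i).1 - q)|) := fun D => by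
    obtain ⟨β, hβ0, hβ1, hβ, hle⟩ := h D
    have hcard : ((neighbors N Δ D x).card : ℝ) - T = ∑ i, (I (D i).1 - q) := by
      rw [card_neighbors, Finset.sum_sub_distrib, hT]
      simp [hI]
    rw [← hcard, ← sub_le_iff_le_add']
    refine excess_le (Nat.cast_nonneg _) hTpos hF2 (mul_nonneg hL hΔ) ?_ ?_
      (abs_success_rate_sub_le hL hπ D x (fun i => ⟨(hB i).1, (hB i).2.trans hb1.le⟩)
        hβ0 hβ1 hβ)
    · have h1 := (risk_mem_Icc (π x) (plugIn (ρ D))).2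
      have h2 : 0 ≤ min (π x : ℝ) (1 - π x) := le_min hp0 (by linarith)
      linarith
    · refine (risk_plugIn_sub_le (π x) (ρ D)).trans ?_
      rw [hF, div_mul_eq_mul_div, le_div_iff₀ hb]
      linarith
  obtain ⟨hi, hieq⟩ := integrable_and_integral_affine hMint hZint (min (π x : ℝ) (1 - π x)) F
    (L * Δ) (2 / T) (4 / √T) (1 / T)
  have hsT : 0 < √T := Real.sqrt_pos.2 hTpos
  have hTs : 1 / T * √T = 1 / √T := by
    nth_rewrite 1 [← Real.mul_self_sqrt hTpos.le]
    field_simp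
  calc ∫ D, risk (π x) (plugIn (ρ D)) ∂(Measure.pi P)
      ≤ ∫ D, (min (π x : ℝ) (1 - π x) +
          F * (L * Δ + 2 / T * |∑ i, neighborResidual N Δ x (m i) (D i)| + 4 / √T +
            1 / T * |∑ i, (I (D i).1 - q)|)) ∂(Measure.pi P) :=
        integral_mono hriskint hi hpt
    _ = min (π x : ℝ) (1 - π x) +
          F * (L * Δ + 2 / T * ∫ D, |∑ i, neighborResidual N Δ x (m i) (D i)| ∂(Measure.pi P) +
            4 / √T + 1 / T * ∫ D, |∑ i, (I (D i).1 - q)| ∂(Measure.pi P)) := hieq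
    _ ≤ min (π x : ℝ) (1 - π x) + F * (L * Δ + 2 / T * √T + 4 / √T + 1 / T * √T) := by gcongr
    -- The constant 7 is 2 (residuals) + 4 (prior and posterior spread) + 1 (neighbour count).
    _ = min (π x : ℝ) (1 - π x) + F * (L * (κ * τ) + 7 * (1 / √T)) := by
        rw [show 2 / T * √T = 2 * (1 / T * √T) by ring, hTs, hw]
        ring
    _ ≤ min (π x : ℝ) (1 - π x) +
          F * (L * (κ * τ) + 7 * (1 / √((κ / A) ^ d) * τ)) := by gcongr
    _ = _ := by ring

/-! ### The three settings -/

lemma integral_id_sbpPosterior {d t : ℕ} (N : Seminorm ℝ (Fin d → ℝ)) (Δ : ℝ) (D : DataSet d t)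
    (x : Cube d) :
    ∫ θ, θ ∂(sbpPosterior N Δ 1 1 D x) =
      (successes D (neighbors N Δ D x) + 1 : ℝ) / ((neighbors N Δ D x).card + 2) := by
  classical
  have h1 : (∑ i, if (D i).2 = true then boxKernel N Δ x (D i).1 else 0) =
      (successes D (neighbors N Δ D x) : ℝ) := by
    rw [successes, Finset.card_filter, neighbors, Finset.sum_filter]
    push_cast
    refine Finset.sum_congr rfl fun i _ => ?_
    by_cases h : cubeDist N x (D i).1 ≤ Δ <;> simp [boxKernel, h]
  have h2 : (∑ i, if (D i).2 = false then boxKernel N Δ x (D i).1 else 0) =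
      ((neighbors N Δ D x).card : ℝ) - successes D (neighbors N Δ D x) := by
    rw [← h1, neighbors, Finset.card_filter]
    push_cast
    rw [← Finset.sum_sub_distrib]
    refine Finset.sum_congr rfl fun i _ => ?_
    cases (D i).2 <;> by_cases h : cubeDist N x (D i).1 ≤ Δ <;> simp [boxKernel, h]
  have h3 : (successes D (neighbors N Δ D x) : ℝ) ≤ (neighbors N Δ D x).card := by
    exact_mod_cast successes_le_card D _
  rw [sbpPosterior, h1, h2, integral_id_betaMeasure (by positivity) (by linarith)]
  congr 1 <;> ring

lemma plugIn_sbpPosterior {d t : ℕ} (N : Seminorm ℝ (Fin d → ℝ)) (Δ : ℝ) (D : DataSet d t)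
    (x : Cube d) :
    plugIn (sbpPosterior N Δ 1 1 D x) =
      decide ((1 : ℝ) / 2 ≤ (((neighbors N Δ D x ∩ successSet D).card : ℕ) + 1 : ℝ) /
        ((neighbors N Δ D x).card + 2)) := by
  rw [plugIn, integral_id_sbpPosterior, successes_eq]

theorem expectedRiskLE_static {d : ℕ} (N : Seminorm ℝ (Fin d → ℝ)) {L κ A : ℝ} (hL : 0 ≤ L)
    (hκ : 0 < κ) (hA : κ ≤ A) (hN : ∀ v, N v ≤ A * ‖v‖) {π : Cube d → unitInterval}
    (hπ : IsLipschitz N L π) {t : ℕ} (ht : 1 ≤ t) (x : Cube d) :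
    ExpectedRiskLE (staticLaw t π) (π x)
      (fun D => plugIn (sbpPosterior N (width d t κ) 1 1 D x))
      ((2 / (1 - 0) * (L * κ + 7 * (1 / √((κ / A) ^ d)))) *
        (t : ℝ) ^ (-(1 / ((d : ℝ) + 2)))) := by
  refine expectedRiskLE_plugIn N hL hκ hA hN le_rfl one_pos ht hπ (B := fun _ => 0)
    (fun _ => ⟨le_rfl, le_rfl⟩) (fun _ => isTrialLaw_trialLaw hπ.measurable fun y => by ring) x
    (fun D => sbpPosterior N (width d t κ) 1 1 D x) ?_
    fun D => ⟨0, le_rfl, zero_le_one, by simp, ?_⟩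
  · simp only [plugIn_sbpPosterior]
    exact measurable_of_neighbors N _ x fun u v =>
      decide ((1 : ℝ) / 2 ≤ (((u ∩ v).card : ℕ) + 1 : ℝ) / (u.card + 2))
  · rw [integral_id_sbpPosterior]
    simp only [sub_zero, one_mul, add_zero]
    have : (0 : ℝ) ≤ 1 / √((neighbors N (width d t κ) D x).card + 2) := by positivity
    linarith

/-- Setting-independent bound for the posteriors with contexts. -/
theorem expectedRiskLE_ctx {d t : ℕ} (N : Seminorm ℝ (Fin d → ℝ)) {L κ A b : ℝ} (hL : 0 ≤ L)
    (hκ : 0 < κ) (hA : κ ≤ A) (hN : ∀ v, N v ≤ A * ‖v‖) (hb0 : 0 ≤ b) (hb1 : b < 1) (ht : 1 ≤ t)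
    {π : Cube d → unitInterval} (hπ : IsLipschitz N L π) {B : Fin t → ℝ}
    (hB : ∀ i, 0 ≤ B i ∧ B i ≤ b) {P : Fin t → Measure (Cube d × Bool)}
    (hP : ∀ i, IsTrialLaw (P i) fun y => (1 - B i) * π y + B i) (x : Cube d)
    (β : Finset (Fin t) → ℝ) (hβ : ∀ s, 0 ≤ β s ∧ β s ≤ b)
    (hβs : ∀ s, s.card * β s = ∑ i ∈ s, B i) :
    ExpectedRiskLE (Measure.pi P) (π x)
      (fun D => plugIn (ctxPosterior 1 1 (β (neighbors N (width d t κ) D x))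
        (neighbors N (width d t κ) D x).card (successes D (neighbors N (width d t κ) D x))))
      ((2 / (1 - b) * (L * κ + 7 * (1 / √((κ / A) ^ d)))) *
        (t : ℝ) ^ (-(1 / ((d : ℝ) + 2)))) := by
  refine expectedRiskLE_plugIn N hL hκ hA hN hb0 hb1 ht hπ hB hP x
    (fun D => ctxPosterior 1 1 (β (neighbors N (width d t κ) D x))
        (neighbors N (width d t κ) D x).card (successes D (neighbors N (width d t κ) D x))) ?_
    fun D => ⟨β (neighbors N (width d t κ) D x), (hβ _).1, (hβ _).2.trans hb1.le, hβs _, ?_⟩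
  · simp only [successes_eq]
    exact measurable_of_neighbors N _ x fun u v =>
      plugIn (ctxPosterior 1 1 (β u) u.card (u ∩ v).card)
  · refine le_trans ?_ (abs_integral_ctxPosterior_sub_le (hβ _).1 ((hβ _).2.trans_lt hb1)
      (successes_le_card D _) (π x).2.1)
    gcongr
    exact (hβ _).2

lemma meanContext_mem {t : ℕ} {B : Fin t → ℝ} {b : ℝ} (hb : 0 ≤ b) (hB : ∀ i, 0 ≤ B i ∧ B i ≤ b)
    (s : Finset (Fin t)) : 0 ≤ meanContext B s ∧ meanContext B s ≤ b := by
  unfold meanContext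
  refine ⟨div_nonneg (Finset.sum_nonneg fun i _ => (hB i).1) (Nat.cast_nonneg _), ?_⟩
  refine div_le_of_le_mul₀ (Nat.cast_nonneg _) hb ?_
  rw [mul_comm, ← nsmul_eq_mul]
  exact Finset.sum_le_card_nsmul _ _ _ fun i _ => (hB i).2

lemma card_mul_meanContext {t : ℕ} (B : Fin t → ℝ) (s : Finset (Fin t)) :
    s.card * meanContext B s = ∑ i ∈ s, B i := by
  unfold meanContext
  rcases s.eq_empty_or_nonempty with rfl | hs
  · simp
  · have : (s.card : ℝ) ≠ 0 := by exact_mod_cast hs.card_ne_zero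
    field_simp

theorem mainTheorem7 (d : ℕ) (N : Seminorm ℝ (Fin d → ℝ)) (hN : ∀ v, N v = 0 → v = 0)
    (L κ : ℝ) (hκ : 0 < κ) :
    -- static setting, Smooth Beta Process
    (∃ C : ℝ, ∀ π : Cube d → unitInterval, IsLipschitz N L π →
      ∀ t : ℕ, 1 ≤ t → ∀ x : Cube d,
        ExpectedRiskLE (staticLaw t π) (π x)
          (fun D => plugIn (sbpPosterior N (width d t κ) 1 1 D x))
          (C * (t : ℝ) ^ (-(1 / ((d : ℝ) + 2))))) ∧
    -- simplified dynamic setting, constant context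
    (∀ B : ℝ, 0 ≤ B → B < 1 →
      ∃ C : ℝ, ∀ π : Cube d → unitInterval, IsLipschitz N L π → (∀ x, 0 < π x) →
        ∀ t : ℕ, 1 ≤ t → ∀ x : Cube d,
          ExpectedRiskLE (constLaw t π B) (π x)
            (fun D => plugIn (dynPosterior N (width d t κ) 1 1 B D x))
            (C * (t : ℝ) ^ (-(1 / ((d : ℝ) + 2))))) ∧
    -- general dynamic setting, noisy varying contexts, Contextual Smooth Beta Process
    (∀ b : ℝ, b < 1 → ∀ σ : ℝ,
      ∃ C : ℝ, ∀ π : Cube d → unitInterval, IsLipschitz N L π → (∀ x, 0 < π x) →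
        ∀ t : ℕ, 1 ≤ t → ∀ B : Fin t → ℝ, (∀ i, 0 ≤ B i ∧ B i ≤ b) →
        ∀ ν : Fin t → Measure ℝ,
          (∀ i, IsProbabilityMeasure (ν i) ∧ MemLp (fun e => e) 2 (ν i) ∧
            ∫ e, e ∂(ν i) = 0 ∧ variance (fun e => e) (ν i) = σ ^ 2 ∧
            ∀ᵐ e ∂(ν i), ∀ x, noisyProb π (B i) e x ∈ Set.Icc (0 : ℝ) 1) →
        ∀ x : Cube d,
          ExpectedRiskLE (noisyLaw π B ν) (π x)
            (fun D => plugIn (csbpPosterior N (width d t κ) 1 1 B D x))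
            (C * (t : ℝ) ^ (-(1 / ((d : ℝ) + 2))))) := by
  -- Taking `A` at least `κ` ensures `Δ ≤ A` for every `t ≥ 1`, as the volume bound requires.
  obtain ⟨A, hA, hNA⟩ : ∃ A, κ ≤ A ∧ ∀ v, N v ≤ A * ‖v‖ :=
    ⟨max κ (∑ j, N (Pi.single j 1)), le_max_left _ _, fun v =>
      (N.le_mul_norm_pi v).trans (mul_le_mul_of_nonneg_right (le_max_right _ _) (norm_nonneg v))⟩
  refine ⟨⟨_, fun π hπ t ht x => expectedRiskLE_static N (abs_nonneg L) hκ hA hNA hπ.abs ht x⟩,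
    fun B hB0 hB1 => ⟨_, fun π hπ _ t ht x => expectedRiskLE_ctx N (abs_nonneg L) hκ hA hNA hB0 hB1
      ht hπ.abs (B := fun _ => B) (fun _ => ⟨hB0, le_rfl⟩) (fun _ => ?_) x (fun _ => B)
      (fun _ => ⟨hB0, le_rfl⟩) fun s => by simp⟩,
    fun b hb σ => ⟨2 / (1 - b) * (|L| * κ + 7 * (1 / √((κ / A) ^ d))),
      fun π hπ _ t ht B hB ν hν x => ?_⟩⟩
  · have hπm := hπ.measurable
    refine isTrialLaw_trialLaw (measurable_toUnit.comp (by fun_prop)) fun y => coe_toUnit ?_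
    have h0 := (π y).2.1
    have h1 : (1 - B) * (π y : ℝ) ≤ (1 - B) * 1 := by
      gcongr
      exact (π y).2.2
    have h2 : 0 ≤ (1 - B) * (π y : ℝ) := mul_nonneg (by linarith) h0
    constructor <;> linarith
  -- Since `t ≥ 1` there is at least one context, which forces `b` to be nonnegative.
  · have hb0 : 0 ≤ b := (hB ⟨0, ht⟩).1.trans (hB ⟨0, ht⟩).2
    refine expectedRiskLE_ctx N (abs_nonneg L) hκ hA hNA hb0 hb ht hπ.abs hB (fun i => ?_) x
      (meanContext B) (meanContext_mem hb0 hB) (card_mul_meanContext B)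
    obtain ⟨h1, h2, h3, -, h4⟩ := hν i
    exact isTrialLaw_noisy hπ.measurable (h2.integrable (by norm_num)) h3 h4
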